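/- Theorem 1.4. For $n \in \mathbb{N} = \{0,1,2,\dots\}$ let $e_{11}(n)$ be the number of (possibly overlapping) occurrences of the block $11$ in the binary expansion of $n$, and let $\mathbf{r} = (r_n)_{n \ge 0}$ with $r_n = e_{11}(n) \bmod 2 \in \{0,1\}$ be the Rudin–Shapiro word. For integers $n \ge 0$ and $d \ge 1$ put $$A_{\mathbf{r}}(n,d) = \inf\{\, l \ge 1 : r_{n+ld} \neq r_n \,\} \in \{1,2,3,\dots\} \cup \{\infty\},$$ the maximal length of a monochromatic arithmetic progression of difference $d$ starting at $n$ in $\mathbf{r}$. Then for all integers $d \ge 3$ we have $$A_{\mathbf{r}}(0,d) \le \tfrac12 (d+3).$$ More precisely, for all integers $d \ge 3$: (i) $A_{\mathbf{r}}(0,d) = (d+3)/2$ if and only if $d = 2^k-1$ for some odd integer $k \ge 3$, or $d = 39$; (ii) $A_{\mathbf{r}}(0,d) = (d+1)/2$ if and only if $d = 2^k+1$ for some integer $k \ge 2$; (iii) $A_{\mathbf{r}}(0,d) < d/2$ for all other $d$ (that is, $d$ of neither of the forms in (i) and (ii)), with the single exception $d = 4$, for which $A_{\mathbf{r}}(0,4)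 = 3$. -/

import Mathlib

namespace RudinShapiro

/-- The canonical binary representation of `n`, most significant digit first, without leading
zeros (the empty word for `n = 0`). -/
def binaryExpansion (n : ℕ) : List ℕ := (Nat.digits 2 n).reverse

/-- The number of (possibly overlapping) occurrences of a nonempty word `v` as a subword of `w`:
occurrences of `v` in `w` correspond to the suffixes of `w` that have `v` as a prefix. -/
def occurrences (v w : List ℕ) : ℕ := w.tails.countP (fun s => v.isPrefixOf s)

/-- `e₁₁(n)`: the number of occurrences of the pattern `11` in the binary expansion of `n`. -/
def e11 (n : ℕ) : ℕ := occurrences [1, 1] (binaryExpansion n)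

/-- The Rudin-Shapiro word over `{0, 1}`. -/
def r (n : ℕ) : ℕ := e11 n % 2

/-- The maximal (possibly infinite) length of a monochromatic arithmetic progression of
difference `d` starting at `n` in the Rudin-Shapiro word:
the infimum of all `l ≥ 1` with `r (n + l d) ≠ r n`, equal to `⊤` if there is no such `l`. -/
noncomputable def A (n d : ℕ) : ℕ∞ := ⨅ (l : ℕ) (_ : 1 ≤ l ∧ r (n + l * d) ≠ r n), (l : ℕ∞)

end RudinShapiro

namespace RudinShapiro

/-! Since r(2n) = r(n), `A 0 d` depends only on the odd part of d, and everything reduces to showing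
that an odd d ≥ 3 with r(ld) = 0 for all l < d/2 (`Monochromatic`) is 2^k + 1, 2^k - 1 with k odd,
or 39. For these d, `A 0 d` is computed directly: a multiple of 2^k ± 1 is a number written next to
itself or next to its complement.

The tool is `Monochromatic.shift`. The multiple (x·2^(M+1) + y)d is 2xd, shifted by M places, plus
yd. Both it and yd have r = 0, and the digits below the cut contribute equally to both, so r(2xd +
⌊yd/2^M⌋) = r(⌊yd/2^M⌋). This plays the trailing digits of xd against the leading digits of yd.

With x = 1 and x = 3, a finite search over both ends of d (`closes_all`) leaves two shapes for d ≥
512: 10…01 and 1…1, with at least seven known digits at each end. If such a d is not 2^K + 1 or 2^N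
- 1, its outer runs of zeros or ones must have equal length (`Monochromatic.zeros_balanced`,
`Monochromatic.ones_balanced`). The shift relation then passes to the digits just inside the runs. A
second finite search (`zeros_window`, `ones_window`) fixes these, and one large multiplier, 2^v + 1
or 2^v - 1, gives the contradiction. Smaller d are checked one by one. -/

/-! ### Digit rules for the Rudin–Shapiro word -/

theorem occurrences_append_singleton (w : List ℕ) (b c : ℕ) :
    occurrences [1, 1] (w ++ [c, b]) =
      occurrences [1, 1] (w ++ [c]) + if c = 1 ∧ b = 1 then 1 else 0 := by
  induction w with
  | nil =>
    have hc : 1 = c ↔ c = 1 := eq_comm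
    have hb : 1 = b ↔ b = 1 := eq_comm
    simp [occurrences, List.isPrefixOf, List.countP_cons, hc, hb]
  | cons a w ih =>
    have key : ∀ v : List ℕ, occurrences [1, 1] (a :: v) =
        occurrences [1, 1] v + if [1, 1].isPrefixOf (a :: v) then 1 else 0 := by
      intro v
      simp [occurrences, List.countP_cons]
    rw [List.cons_append, List.cons_append, key, key, ih]
    cases w with
    | nil => simp [List.isPrefixOf]; omega
    | cons x w => simp [List.isPrefixOf]; omega

theorem e11_two_mul_add (n b : ℕ) (hb : b < 2) :
    e11 (2 * n + b) = e11 n + if n % 2 = 1 ∧ b = 1 then 1 else 0 := by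
  rcases Nat.eq_zero_or_pos n with rfl | hn
  · interval_cases b <;> simp [e11, binaryExpansion, occurrences, List.isPrefixOf]
  · have h1 : Nat.digits 2 (2 * n + b) = b :: Nat.digits 2 n := by
      rw [add_comm, Nat.digits_add 2 (by norm_num) b n hb (Or.inr hn.ne')]
    have h2 : Nat.digits 2 n = n % 2 :: Nat.digits 2 (n / 2) :=
      Nat.digits_def' (by norm_num) hn
    unfold e11 binaryExpansion
    rw [h1, h2]
    simpa using occurrences_append_singleton (Nat.digits 2 (n / 2)).reverse b (n % 2)

theorem r_lt_two (n : ℕ) : r n < 2 := Nat.mod_lt _ (by norm_num)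

@[simp] theorem r_zero : r 0 = 0 := by decide

@[simp] theorem r_two_mul (n : ℕ) : r (2 * n) = r n := by
  have := e11_two_mul_add n 0 (by norm_num)
  simp at this
  simp [r, this]

theorem r_two_mul_add_one (n : ℕ) : r (2 * n + 1) = (r n + n) % 2 := by
  have := e11_two_mul_add n 1 (by norm_num)
  simp only [r, this]
  split_ifs with h <;> simp at h <;> omega

/-- Two summands whose supports overlap only above position `M` interact only through their
truncations at `M`. -/
theorem r_glue (n M y : ℕ) :
    (r (2 * n * 2 ^ M + y) + r y) % 2 = (r (2 * n + y / 2 ^ M) + r (y / 2 ^ M)) % 2 := by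
  -- As 2n is even, the sum agrees with y in all positions up to M, so the pairs of digits lost by
  -- truncation are the same in both terms.
  induction M generalizing y with
  | zero => simp
  | succ M ih =>
    have h := ih (y / 2)
    rw [Nat.div_div_eq_div_mul, ← pow_succ'] at h
    rw [← h]
    have e1 : 2 * n * 2 ^ (M + 1) = 2 * (2 * (n * 2 ^ M)) := by ring
    have e2 : 2 * n * 2 ^ M = 2 * (n * 2 ^ M) := by ring
    rw [e1, e2]
    generalize n * 2 ^ M = t
    rcases Nat.even_or_odd' y with ⟨z, rfl | rfl⟩
    · rw [← mul_add, r_two_mul, r_two_mul]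
      simp
    · rw [← add_assoc, ← mul_add, r_two_mul_add_one, r_two_mul_add_one,
        show (2 * z + 1) / 2 = z by omega]
      omega

/-- The only pair not inside one of the two blocks joins the last digit of a to the digit of b at
position m. -/
theorem r_concat (a m b : ℕ) (hb : b < 2 ^ (m + 1)) :
    r (a * 2 ^ (m + 1) + b) = (r a + r b + a * (b / 2 ^ m)) % 2 := by
  induction m generalizing b with
  | zero =>
    have h0 := r_lt_two a
    have h1 : r 1 = 0 := by decide
    simp only [zero_add, pow_one] at hb ⊢
    interval_cases b
    · simp [mul_comm a 2, Nat.mod_eq_of_lt h0]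
    · rw [mul_comm, r_two_mul_add_one]; simp [h1]
  | succ m ih =>
    have h := ih (b / 2) (by rw [pow_succ] at hb; omega)
    rw [Nat.div_div_eq_div_mul, ← pow_succ'] at h
    have e1 : a * 2 ^ (m + 1 + 1) = 2 * (a * 2 ^ (m + 1)) := by ring
    have e2 : a * 2 ^ (m + 1) = 2 * (a * 2 ^ m) := by ring
    rw [e1]
    rcases Nat.even_or_odd' b with ⟨z, rfl | rfl⟩
    · rw [← mul_add, r_two_mul, r_two_mul]
      simpa using h
    · rw [show (2 * z + 1) / 2 = z by omega] at h
      rw [← add_assoc, ← mul_add, r_two_mul_add_one, r_two_mul_add_one, h]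
      rw [e2]
      omega

theorem r_concat_of_lt (a m b : ℕ) (hb : b < 2 ^ m) :
    r (a * 2 ^ (m + 1) + b) = (r a + r b) % 2 := by
  rw [r_concat a m b (by rw [pow_succ]; omega), Nat.div_eq_of_lt hb]
  simp

theorem r_concat_of_le (a m b : ℕ) (hb : 2 ^ m ≤ b) (hb' : b < 2 ^ (m + 1)) :
    r (a * 2 ^ (m + 1) + b) = (r a + r b + a) % 2 := by
  rw [r_concat a m b hb', Nat.div_eq_of_lt_le (k := 1) (by simpa using hb)
    (by rw [pow_succ] at hb'; omega)]
  simp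

/-- Complementing the lowest `m + 1` digits. -/
theorem r_complement (z m c : ℕ) (hc : c < 2 ^ m) :
    r (z * 2 ^ (m + 1) + (2 ^ (m + 1) - 1 - c)) = (r z + z + m + c + r c) % 2 := by
  -- On a pair of digits (1-a)(1-b) = 1 - a - b + ab. Summed over the m pairs, inner digits count
  -- twice and the top digit of c is 0, so m + c + r(c) remains modulo 2. The term z is the junction
  -- with the leading 1 of the complement.
  induction m generalizing c with
  | zero =>
    obtain rfl : c = 0 := by simpa using hc
    simpa [mul_comm] using r_two_mul_add_one z
  | succ m ih =>
    have h := ih (c / 2) (by rw [pow_succ] at hc; omega)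
    have e1 : 2 ^ (m + 1 + 1) = 2 * 2 ^ (m + 1) := by ring
    have e2 : 2 ^ (m + 1) = 2 * 2 ^ m := by ring
    have e3 : z * 2 ^ (m + 1) = 2 * (z * 2 ^ m) := by ring
    have hz := r_lt_two z
    have hr := r_lt_two c
    rcases Nat.even_or_odd' c with ⟨q, rfl | rfl⟩
    · rw [show 2 * q / 2 = q by omega] at h
      have : z * 2 ^ (m + 1 + 1) + (2 ^ (m + 1 + 1) - 1 - 2 * q) =
        2 * (z * 2 ^ (m + 1) + (2 ^ (m + 1) - 1 - q)) + 1 := by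
        rw [mul_add, e1]
        have : z * (2 * 2 ^ (m + 1)) = 2 * (z * 2 ^ (m + 1)) := by ring
        omega
      rw [this, r_two_mul_add_one, h, r_two_mul]
      rw [e3]; omega
    · rw [show (2 * q + 1) / 2 = q by omega] at h
      have : z * 2 ^ (m + 1 + 1) + (2 ^ (m + 1 + 1) - 1 - (2 * q + 1)) =
        2 * (z * 2 ^ (m + 1) + (2 ^ (m + 1) - 1 - q)) := by
        rw [mul_add, e1]
        have : z * (2 * 2 ^ (m + 1)) = 2 * (z * 2 ^ (m + 1)) := by ring
        omega
      rw [this, r_two_mul, h, r_two_mul_add_one]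
      omega

/-! ### The shift relation -/

/-- All terms of index `l * d` with `2 * l < d` of the Rudin-Shapiro word vanish. -/
def Monochromatic (d : ℕ) : Prop := ∀ l, 2 * l < d → r (l * d) = 0

/-- The multiplier x·2^(M+1) + y and its part y are both in the monochromatic range, so `r_glue`
applies with both left-hand terms zero. -/
theorem Monochromatic.shift {d : ℕ} (h : Monochromatic d) (x y M : ℕ)
    (hb : 2 * (x * 2 ^ (M + 1) + y) < d) :
    r (2 * (x * d) + y * d / 2 ^ M) = r (y * d / 2 ^ M) := by
  have h1 := r_glue (x * d) M (y * d)
  have h2 : 2 * (x * d) * 2 ^ M + y * d = (x * 2 ^ (M + 1) + y) * d := by ring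
  have hp : 0 ≤ x * 2 ^ (M + 1) := Nat.zero_le _
  rw [h2, h _ hb, h y (by omega)] at h1
  have := r_lt_two (2 * (x * d) + y * d / 2 ^ M)
  have := r_lt_two (y * d / 2 ^ M)
  omega

/-! ### Finite search on the outer digits -/

/-- Fuelled evaluation of the Rudin-Shapiro word, suited to kernel computation. -/
def evalAux : ℕ → ℕ → Bool
  | 0, _ => false
  | f + 1, n => bif Nat.beq n 0 then false else Nat.beq (n % 4) 3 ^^ evalAux f (n / 2)

/-- The Rudin-Shapiro word as a boolean. -/
def eval (n : ℕ) : Bool := evalAux n n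

theorem beq_iff {a b : ℕ} : Nat.beq a b = true ↔ a = b :=
  ⟨Nat.eq_of_beq_eq_true, by rintro rfl; exact Nat.beq_refl _⟩

theorem blt_iff {a b : ℕ} : Nat.blt a b = true ↔ a < b := by
  simp [Nat.blt_eq]

theorem evalAux_toNat (f n : ℕ) (h : n ≤ f) : (evalAux f n).toNat = r n := by
  induction f generalizing n with
  | zero => obtain rfl : n = 0 := by omega
            simp [evalAux]
  | succ f ih =>
    rcases Nat.eq_zero_or_pos n with rfl | hn
    · simp [evalAux]
    · have h1 := ih (n / 2) (by omega)
      have h0 : Nat.beq n 0 = false := by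
        rw [← Bool.not_eq_true, beq_iff]; omega
      have hr : r n = (r (n / 2) + (if n % 4 = 3 then 1 else 0)) % 2 := by
        have := r_lt_two (n / 2)
        rcases Nat.even_or_odd' n with ⟨q, rfl | rfl⟩
        · rw [r_two_mul, show 2 * q / 2 = q by omega] at *
          split_ifs <;> omega
        · rw [r_two_mul_add_one, show (2 * q + 1) / 2 = q by omega] at *
          split_ifs <;> omega
      rw [hr, ← h1, evalAux, h0]
      by_cases h4 : n % 4 = 3
      · have : Nat.beq (n % 4) 3 = true := beq_iff.2 h4
        rw [this, if_pos h4]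
        cases evalAux f (n / 2) <;> rfl
      · have : Nat.beq (n % 4) 3 = false := by
          rw [← Bool.not_eq_true, beq_iff]; exact h4
        rw [this, if_neg h4]
        cases evalAux f (n / 2) <;> rfl

theorem eval_toNat (n : ℕ) : (eval n).toNat = r n := evalAux_toNat n n le_rfl

theorem bool_eq_of_toNat {a b : Bool} (h : a.toNat = b.toNat) : a = b := by
  cases a <;> cases b <;> simp_all

theorem xor_toNat (a b : Bool) : (a ^^ b).toNat = (a.toNat + b.toNat) % 2 := by
  cases a <;> cases b <;> rfl

/-- The value of the Rudin-Shapiro word at `U * (2 * H) + f`, where `H` is a power of `2` and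
`f < 3 * H`, in terms of its value `α` at `U`, the parity `β` of `U`, and its value `γ` at
`U + 1`. -/
def windowValue (H : ℕ) (α β γ : Bool) (f : ℕ) : Bool :=
  bif Nat.blt f H then α ^^ eval f
  else bif Nat.blt f (2 * H) then (α ^^ β) ^^ eval f
  else γ ^^ eval (f - 2 * H)

/-- No choice of `α, β, γ` is compatible with the list of prescribed values. -/
def inconsistent (H base : ℕ) (l : List (ℕ × Bool)) : Bool :=
  [false, true].all fun α => [false, true].all fun β => [false, true].all fun γ =>
    l.any fun c => Nat.blt (base + c.1) (3 * H) && (windowValue H α β γ (base + c.1) ^^ c.2)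

theorem windowValue_toNat (m U f : ℕ) (hf : f < 3 * 2 ^ m) :
    (windowValue (2 ^ m) (eval U) (Nat.beq (U % 2) 1) (eval (U + 1)) f).toNat =
      r (U * 2 ^ (m + 1) + f) := by
  have e : 2 ^ (m + 1) = 2 * 2 ^ m := by ring
  unfold windowValue
  by_cases h1 : f < 2 ^ m
  · rw [blt_iff.2 h1, cond_true, xor_toNat, eval_toNat, eval_toNat, r_concat_of_lt _ _ _ h1]
  · rw [Bool.eq_false_iff.2 (fun h => h1 (blt_iff.1 h)), cond_false]
    by_cases h2 : f < 2 * 2 ^ m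
    · rw [blt_iff.2 h2, cond_true, xor_toNat, xor_toNat, eval_toNat, eval_toNat,
        r_concat_of_le _ _ _ (by omega) (by omega)]
      have : (Nat.beq (U % 2) 1).toNat = U % 2 := by
        rcases Nat.mod_two_eq_zero_or_one U with h | h <;> rw [h] <;> rfl
      omega
    · rw [Bool.eq_false_iff.2 (fun h => h2 (blt_iff.1 h)), cond_false, xor_toNat, eval_toNat,
        eval_toNat, ← r_concat_of_lt _ m _ (by omega)]
      congr 1
      rw [add_mul]
      omega

theorem inconsistent_sound {m n base : ℕ} {l : List (ℕ × Bool)}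
    (hc : inconsistent (2 ^ m) base l = true) (hn : n % 2 ^ (m + 1) = base)
    (h : ∀ c ∈ l, r (n + c.1) = c.2.toNat) : False := by
  set U := n / 2 ^ (m + 1)
  have hU : n = U * 2 ^ (m + 1) + base := by
    rw [← hn, mul_comm]; exact (Nat.div_add_mod _ _).symm
  simp only [inconsistent, List.all_eq_true] at hc
  have hb : ∀ b : Bool, b ∈ [false, true] := by decide
  have := hc (eval U) (hb _) (Nat.beq (U % 2) 1) (hb _) (eval (U + 1)) (hb _)
  obtain ⟨c, hcl, hv⟩ := List.any_eq_true.1 this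
  rw [Bool.and_eq_true] at hv
  have h1 := windowValue_toNat m U (base + c.1) (blt_iff.1 hv.1)
  rw [← add_assoc, ← hU, h c hcl] at h1
  rw [bool_eq_of_toNat h1] at hv
  simp at hv

/-- The values of `⌊y * d / 2 ^ M⌋` determined by the leading digits `T` of `d`, listed together with their
Rudin-Shapiro values. -/
def shiftConstraints (s T j₀ : ℕ) : List (ℕ × Bool) :=
  -- The first entry is y = 0. Only odd y are listed, since doubling y amounts to lowering the cut.
  -- The range of q keeps the multiplier below d/2.
  (0, false) :: (List.range 16).flatMap fun i => (List.range (s - j₀)).filterMap fun q =>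
    bif Nat.beq ((2 * i + 1) * T / 2 ^ q) (((2 * i + 1) * (T + 1) - 1) / 2 ^ q) then
      some ((2 * i + 1) * T / 2 ^ q, eval ((2 * i + 1) * T / 2 ^ q))
    else none

/-- The windows `T` and `L` are incompatible with `Monochromatic`. -/
def excludes (s T L : ℕ) : Bool :=
  -- The multipliers x = 1 and x = 3, whose cuts must stay 3 and 4 places further from the top.
  inconsistent (2 ^ s) (2 * L) (shiftConstraints s T 3) ||
    inconsistent (2 ^ s) (2 * (3 * L) % 2 ^ (s + 1)) (shiftConstraints s T 4)

theorem div_eq_of_between {n t q T y : ℕ} (h1 : y * T * 2 ^ t ≤ n)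
    (h2 : n < y * (T + 1) * 2 ^ t) (h : y * T / 2 ^ q = (y * (T + 1) - 1) / 2 ^ q) :
    n / 2 ^ (t + q) = y * T / 2 ^ q := by
  have ht : 0 < 2 ^ t := by positivity
  rw [pow_add, ← Nat.div_div_eq_div_mul]
  have h3 : y * T ≤ n / 2 ^ t := (Nat.le_div_iff_mul_le ht).2 h1
  have h4 : n / 2 ^ t ≤ y * (T + 1) - 1 :=
    Nat.le_sub_one_of_lt ((Nat.div_lt_iff_lt_mul ht).2 h2)
  apply le_antisymm
  · rw [h]; exact Nat.div_le_div_right h4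
  · exact Nat.div_le_div_right h3

theorem leading_bounds (d t : ℕ) :
    d / 2 ^ t * 2 ^ t ≤ d ∧ d < (d / 2 ^ t + 1) * 2 ^ t :=
  ⟨Nat.div_mul_le_self _ _, by rw [mul_comm]; exact Nat.lt_mul_div_succ d (by positivity)⟩

theorem div_eq_of_leading {d t q T y : ℕ} (hT : d / 2 ^ t = T)
    (h : y * T / 2 ^ q = (y * (T + 1) - 1) / 2 ^ q) (hy : 0 < y) :
    y * d / 2 ^ (t + q) = y * T / 2 ^ q := by
  obtain ⟨h1, h2⟩ := leading_bounds d t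
  rw [hT] at h1 h2
  refine div_eq_of_between ?_ ?_ h
  · rw [mul_assoc]; exact Nat.mul_le_mul_left _ h1
  · rw [mul_assoc]; exact Nat.mul_lt_mul_of_pos_left h2 hy

/-- The bound on x gives 2x·2^(M+1) ≤ (3/4)·2^(k-1). The remaining quarter is at least 128 because k
≥ 10, and it absorbs 2y ≤ 62. -/
theorem Monochromatic.shiftConstraints {d k s T x j₀ : ℕ} (h : Monochromatic d)
    (hd : 2 ^ (k - 1) ≤ d) (hk : 10 ≤ k) (hs : s ≤ 10) (hT : d / 2 ^ (k - s) = T)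
    (hx : 16 * x ≤ 3 * 2 ^ j₀) (hj : 3 ≤ j₀) (hj' : j₀ ≤ 4) :
    ∀ c ∈ shiftConstraints s T j₀, r (2 * (x * d) + c.1) = c.2.toNat := by
  have hk1 : 2 ^ (k - 1) = 2 ^ (k - 10) * 512 := by
    rw [show k - 1 = k - 10 + 9 by omega, pow_add]; norm_num
  have hpos : 0 < 2 ^ (k - 10) := by positivity
  have hshift : ∀ y M, y ≤ 31 → M + j₀ + 1 ≤ k → 2 * (x * 2 ^ (M + 1) + y) < d := by
    intro y M hy hM
    have h1 : 16 * (x * 2 ^ (M + 1)) ≤ 6 * 2 ^ (k - 1) := by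
      calc 16 * (x * 2 ^ (M + 1)) = 16 * x * 2 ^ (M + 1) := by ring
        _ ≤ 3 * 2 ^ j₀ * 2 ^ (M + 1) := Nat.mul_le_mul_right _ hx
        _ = 3 * 2 ^ (j₀ + (M + 1)) := by rw [pow_add]; ring
        _ ≤ 3 * 2 ^ (k - 1 + 1) :=
          Nat.mul_le_mul_left _ (Nat.pow_le_pow_right (by norm_num) (by omega))
        _ = 6 * 2 ^ (k - 1) := by ring
    omega
  intro c hc
  rw [RudinShapiro.shiftConstraints, List.mem_cons] at hc
  rcases hc with rfl | hc
  · have := h.shift x 0 _ (hshift 0 (k - j₀ - 1) (by norm_num) (by omega))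
    simpa using this
  · simp only [List.mem_flatMap, List.mem_filterMap, List.mem_range] at hc
    obtain ⟨i, hi, q, hq, hc⟩ := hc
    by_cases he : (2 * i + 1) * T / 2 ^ q = ((2 * i + 1) * (T + 1) - 1) / 2 ^ q
    · rw [show Nat.beq _ _ = true from beq_iff.2 he, cond_true, Option.some_inj] at hc
      subst hc
      rw [eval_toNat]
      have e := div_eq_of_leading hT he (by omega)
      rw [← e]
      exact h.shift x _ _ (hshift _ _ (by omega) (by omega))
    · rw [show Nat.beq _ _ = false by rw [← Bool.not_eq_true, beq_iff]; exact he] at hc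
      simp at hc

theorem Monochromatic.not_excludes {d k s : ℕ} (h : Monochromatic d)
    (hd : 2 ^ (k - 1) ≤ d) (hk : 10 ≤ k) (hs : s ≤ 10) :
    excludes s (d / 2 ^ (k - s)) (d % 2 ^ s) = false := by
  rw [← Bool.not_eq_true]
  intro he
  rw [excludes, Bool.or_eq_true] at he
  rcases he with he | he
  · refine inconsistent_sound he (n := 2 * (1 * d)) ?_
      (h.shiftConstraints hd hk hs rfl (by norm_num) (by norm_num) (by norm_num))
    rw [one_mul, pow_succ', Nat.mul_mod_mul_left]
  · refine inconsistent_sound he (n := 2 * (3 * d)) ?_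
      (h.shiftConstraints hd hk hs rfl (by norm_num) (by norm_num) (by norm_num))
    rw [pow_succ', Nat.mul_mod_mul_left, Nat.mul_mod_mul_left, Nat.mul_mod_mod]

/-- Every refinement of the window with leading digits `T` and trailing digits `L` is excluded,
up to the windows `1000000…0000001` and `1111111…1111111`. -/
def closes : ℕ → ℕ → ℕ → ℕ → Bool
  | 0, _, _, _ => false
  | f + 1, s, T, L =>
    (Nat.beq s 7 && ((Nat.beq T 64 && Nat.beq L 1) || (Nat.beq T 127 && Nat.beq L 127))) ||
    (excludes s T L || ((closes f (s + 1) (2 * T) L && closes f (s + 1) (2 * T) (2 ^ s + L)) &&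
      (closes f (s + 1) (2 * T + 1) L && closes f (s + 1) (2 * T + 1) (2 ^ s + L))))

theorem closes_all : ((List.range 32).all fun t => (List.range 32).all fun l =>
    closes 5 6 (32 + t) (2 * l + 1)) = true := by
  decide +kernel

theorem Monochromatic.ends_of_closes {d k : ℕ} (h : Monochromatic d)
    (hd : 2 ^ (k - 1) ≤ d) (hk : 10 ≤ k) (f s : ℕ) (hs : s + f ≤ 11)
    (hc : closes f s (d / 2 ^ (k - s)) (d % 2 ^ s) = true) :
    (d / 2 ^ (k - 7) = 64 ∧ d % 2 ^ 7 = 1) ∨ (d / 2 ^ (k - 7) = 127 ∧ d % 2 ^ 7 = 127) := by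
  induction f generalizing s with
  | zero => simp [closes] at hc
  | succ f ih =>
    rw [closes, h.not_excludes hd hk (by omega), Bool.false_or, Bool.or_eq_true] at hc
    rcases hc with hc | hc
    · simp only [Bool.and_eq_true, Bool.or_eq_true, beq_iff] at hc
      obtain ⟨rfl, hc⟩ := hc
      exact hc
    · simp only [Bool.and_eq_true] at hc
      obtain ⟨⟨h1, h2⟩, h3, h4⟩ := hc
      rcases Nat.eq_zero_or_pos f with rfl | hf
      · simp [closes] at h1
      apply ih (s + 1) (by omega)
      have hT : d / 2 ^ (k - s) = d / 2 ^ (k - (s + 1)) / 2 := by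
        rw [Nat.div_div_eq_div_mul, ← pow_succ, show k - (s + 1) + 1 = k - s by omega]
      have hL : d % 2 ^ (s + 1) = d % 2 ^ s + 2 ^ s * (d / 2 ^ s % 2) := Nat.mod_pow_succ
      rw [hL]
      rw [hT] at h1 h2 h3 h4
      generalize d / 2 ^ (k - (s + 1)) = T at *
      rcases Nat.mod_two_eq_zero_or_one (d / 2 ^ s) with hb | hb <;>
        simp only [hb, mul_zero, add_zero, mul_one] <;>
        rcases Nat.even_or_odd' T with ⟨q, rfl | rfl⟩
      · rwa [show 2 * q / 2 = q by omega] at h1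
      · rwa [show (2 * q + 1) / 2 = q by omega] at h3
      · rwa [show 2 * q / 2 = q by omega, add_comm (2 ^ s)] at h2
      · rwa [show (2 * q + 1) / 2 = q by omega, add_comm (2 ^ s)] at h4

theorem Monochromatic.ends {d k : ℕ} (h : Monochromatic d) (hodd : d % 2 = 1)
    (hd : 2 ^ (k - 1) ≤ d) (hd' : d < 2 ^ k) (hk : 10 ≤ k) :
    (d / 2 ^ (k - 7) = 64 ∧ d % 2 ^ 7 = 1) ∨ (d / 2 ^ (k - 7) = 127 ∧ d % 2 ^ 7 = 127) := by
  -- Windows grow from 6 to at most 10 digits, all available since k ≥ 10.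
  apply h.ends_of_closes hd hk 5 6 (by norm_num)
  have h1 : d / 2 ^ (k - 6) < 64 := by
    rw [Nat.div_lt_iff_lt_mul (by positivity)]
    calc d < 2 ^ k := hd'
      _ = 64 * 2 ^ (k - 6) := by
        rw [show (64 : ℕ) = 2 ^ 6 by norm_num, ← pow_add]; congr 1; omega
  have h2 : 32 ≤ d / 2 ^ (k - 6) := by
    rw [Nat.le_div_iff_mul_le (by positivity)]
    calc 32 * 2 ^ (k - 6) = 2 ^ (k - 1) := by
          rw [show (32 : ℕ) = 2 ^ 5 by norm_num, ← pow_add]; congr 1; omega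
      _ ≤ d := hd
  have h3 := List.all_eq_true.1 closes_all (d / 2 ^ (k - 6) - 32) (by rw [List.mem_range]; omega)
  have h4 := List.all_eq_true.1 h3 (d % 2 ^ 6 / 2) (by rw [List.mem_range]; omega)
  rwa [show 32 + (d / 2 ^ (k - 6) - 32) = d / 2 ^ (k - 6) by omega,
    show 2 * (d % 2 ^ 6 / 2) + 1 = d % 2 ^ 6 by omega] at h4

/-! ### The shape 10…01 -/

theorem r_two_pow_add (a b : ℕ) (hb : 2 * b < 2 ^ a) : r (2 ^ a + b) = r b := by
  rcases a with _ | a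
  · obtain rfl : b = 0 := by simp at hb; omega
    decide
  · have h1 : r 1 = 0 := by decide
    have := r_concat_of_lt 1 a b (by rw [pow_succ] at hb; omega)
    rw [one_mul] at this
    rw [this, h1, zero_add, Nat.mod_eq_of_lt (r_lt_two b)]

theorem r_two_pow (a : ℕ) : r (2 ^ a) = 0 := by
  simpa using r_two_pow_add a 0 (by simp)

theorem Monochromatic.r_self {d : ℕ} (h : Monochromatic d) (hd : 3 ≤ d) : r d = 0 := by
  simpa using h 1 (by omega)

/-- A number `2 ^ K + e = 1 + u * 2 ^ v` with `2 ^ j < e < 2 ^ (j + 1)` can only be monochromatic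
if it has as many leading as trailing zeros between its outer ones. -/
theorem Monochromatic.zeros_balanced {d K j u v e : ℕ} (h : Monochromatic d)
    (hK : d = 2 ^ K + e) (he : 2 ^ j ≤ e) (he' : e < 2 ^ (j + 1)) (hj : j + 7 ≤ K)
    (hu : d = u * 2 ^ v + 1) (hodd : u % 2 = 1) (hv : 7 ≤ v) (hvK : v ≤ K) : j + v = K := by
  obtain ⟨v, rfl⟩ : ∃ v', v = v' + 1 := ⟨v - 1, by omega⟩
  have hK2 : 128 * 2 ^ j ≤ 2 ^ K := by
    calc 128 * 2 ^ j = 2 ^ (j + 7) := by rw [pow_add]; ring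
      _ ≤ 2 ^ K := Nat.pow_le_pow_right (by norm_num) hj
  have hj0 : 0 < 2 ^ j := by positivity
  have hv2 : 64 ≤ 2 ^ v := by
    calc 64 = 2 ^ 6 := by norm_num
      _ ≤ 2 ^ v := Nat.pow_le_pow_right (by norm_num) (by omega)
  have e1 : 2 ^ (v + 1) = 2 * 2 ^ v := by ring
  have e2 : 2 ^ (j + 1) = 2 * 2 ^ j := by ring
  have r1 : r 1 = 0 := by decide
  have hru : r u = 0 := by
    have h0 := h.r_self (by omega)
    rw [hu, r_concat_of_lt u v 1 (by omega), r1] at h0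
    have := r_lt_two u
    omega
  have h2d : 2 * (1 * d) = u * 2 ^ (v + 1 + 1) + 2 := by rw [hu]; ring
  rcases lt_trichotomy (j + (v + 1)) K with hlt | heq | hgt
  -- The cut keeps a single 1 and some zeros; added to 2d, this 1 lands next to the last digit 1 of
  -- u and creates one block 11.
  · have hA : 1 * d / 2 ^ (K - (v + 1)) = 2 ^ (v + 1) := by
      rw [one_mul, hK]
      have e3 : 2 ^ K = 2 ^ (v + 1) * 2 ^ (K - (v + 1)) := by rw [← pow_add]; congr 1; omega
      have e4 : e < 2 ^ (K - (v + 1)) :=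
        he'.trans_le (Nat.pow_le_pow_right (by norm_num) (by omega))
      rw [e3, add_comm, Nat.add_mul_div_right _ _ (by positivity), Nat.div_eq_of_lt e4, zero_add]
    have hs := h.shift 1 1 (K - (v + 1)) (by
      have : 4 * 2 ^ (K - (v + 1) + 1) ≤ 2 ^ K := by
        calc 4 * 2 ^ (K - (v + 1) + 1) = 2 ^ (K - (v + 1) + 3) := by ring
          _ ≤ 2 ^ K := Nat.pow_le_pow_right (by norm_num) (by omega)
      omega)
    rw [hA, h2d, r_two_pow, add_assoc, r_concat_of_le _ _ _ (by omega) (by omega), add_comm 2,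
      r_two_pow_add _ _ (by omega), hru, show r 2 = 0 by decide] at hs
    omega
  · exact heq
  -- The cut now ends in the leading 1 of e, which meets the last 1 of 2d: 2 + 1 = 3 is the new
  -- block 11.
  · have hA : 1 * d / 2 ^ j = 2 ^ (K - j) + 1 := by
      rw [one_mul, hK]
      have e3 : 2 ^ K = 2 ^ (K - j) * 2 ^ j := by rw [← pow_add]; congr 1; omega
      rw [e3, add_comm, Nat.add_mul_div_right _ _ (by positivity), add_comm]
      congr 1
      exact Nat.div_eq_of_lt_le (by simpa using he) (by omega)
    have hs := h.shift 1 1 j (by omega)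
    have h1 : 2 ^ (K - j) ≤ 2 ^ v := Nat.pow_le_pow_right (by norm_num) (by omega)
    have h2 : 128 ≤ 2 ^ (K - j) := by
      calc 128 = 2 ^ 7 := by norm_num
        _ ≤ 2 ^ (K - j) := Nat.pow_le_pow_right (by norm_num) (by omega)
    rw [hA, h2d, r_two_pow_add _ _ (by omega), add_assoc, r_concat_of_lt _ _ _ (by omega),
      show 2 + (2 ^ (K - j) + 1) = 2 ^ (K - j) + 3 by ring, r_two_pow_add _ _ (by omega), hru,
      show r 3 = 1 by decide, r1] at hs
    omega

/-- For balanced `d`, the digits `u` above the trailing block and `e` below the leading block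
interact only through their outer digits. -/
theorem Monochromatic.zeros_step {d j u v e x y : ℕ} (h : Monochromatic d)
    (hK : d = 2 ^ (j + v) + e) (he' : e < 2 ^ (j + 1)) (hj : 1 ≤ j)
    (hu : d = u * 2 ^ v + 1) (hv : 7 ≤ v) (hx : x ≤ 7) (hy : y ≤ 15) :
    (r (x * u + y) + r (2 * x + y * e / 2 ^ (j - 1))) % 2 =
      (r y + r (y * e / 2 ^ (j - 1))) % 2 := by
  obtain ⟨i, rfl⟩ : ∃ i, j = i + 1 := ⟨j - 1, by omega⟩
  rw [Nat.add_sub_cancel]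
  have hi : 0 < 2 ^ i := by positivity
  have hv2 : 128 ≤ 2 ^ v := by
    calc 128 = 2 ^ 7 := by norm_num
      _ ≤ 2 ^ v := Nat.pow_le_pow_right (by norm_num) (by omega)
  have hG : y * e / 2 ^ i < 60 := by
    rw [Nat.div_lt_iff_lt_mul hi]
    rw [show 2 ^ (i + 1 + 1) = 4 * 2 ^ i by ring] at he'
    calc y * e ≤ 15 * e := Nat.mul_le_mul_right _ hy
      _ < 60 * 2 ^ i := by omega
  have hA : y * d / 2 ^ i = y * 2 ^ (v + 1) + y * e / 2 ^ i := by
    rw [hK, show y * (2 ^ (i + 1 + v) + e) = y * e + y * 2 ^ (v + 1) * 2 ^ i by ring,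
      Nat.add_mul_div_right _ _ hi, add_comm]
  have hs := h.shift x y i (by
    have h1 : x * 2 ^ (i + 1) ≤ 7 * 2 ^ (i + 1) := Nat.mul_le_mul_right _ hx
    have h2 : 128 * 2 ^ (i + 1) ≤ 2 ^ (i + 1 + v) := by
      rw [pow_add _ _ v, mul_comm]
      exact Nat.mul_le_mul_left _ hv2
    rw [show 2 ^ (i + 1) = 2 * 2 ^ i by ring] at h1 h2 ⊢
    omega)
  have h3 : 2 * (x * d) + y * d / 2 ^ i =
      (x * u + y) * 2 ^ (v + 1) + (2 * x + y * e / 2 ^ i) := by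
    rw [hA, hu]; ring
  rw [h3, hA, r_concat_of_lt _ _ _ (by omega), r_concat_of_lt _ _ _ (by omega)] at hs
  exact hs

/-- The instances of `Monochromatic.zeros_step` determined by the leading digits `T` of `e`. -/
def zerosConstraints (T x : ℕ) : List (ℕ × Bool) :=
  (0, eval (2 * x)) :: (List.range 15).filterMap fun i =>
    bif Nat.beq ((i + 1) * T / 2 ^ 3) (((i + 1) * (T + 1) - 1) / 2 ^ 3) then
      some (i + 1, eval (2 * x + (i + 1) * T / 2 ^ 3) ^^ (eval (i + 1) ^^ eval ((i + 1) * T / 2 ^ 3)))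
    else none

/-- The only surviving pair is e = 10000… and u = …00001. -/
theorem zeros_window : ((List.range 16).all fun t => (List.range 16).all fun l =>
    (Nat.beq t 0 && Nat.beq l 0) || (List.range 8).any fun x =>
      inconsistent (2 ^ 4) (x * (2 * l + 1) % 2 ^ 5) (zerosConstraints (16 + t) x)) = true := by
  decide +kernel

theorem Monochromatic.zeros_ends {d j u v e : ℕ} (h : Monochromatic d)
    (hK : d = 2 ^ (j + v) + e) (he : 2 ^ j ≤ e) (he' : e < 2 ^ (j + 1)) (hj : 7 ≤ j)
    (hu : d = u * 2 ^ v + 1) (hodd : u % 2 = 1) (hv : 7 ≤ v) :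
    e / 2 ^ (j - 4) = 16 ∧ u % 32 = 1 := by
  have hj4 : 0 < 2 ^ (j - 4) := by positivity
  have ej : 2 ^ j = 16 * 2 ^ (j - 4) := by
    rw [show (16 : ℕ) = 2 ^ 4 by norm_num, ← pow_add]; congr 1; omega
  have h1 : e / 2 ^ (j - 4) < 32 := by
    rw [Nat.div_lt_iff_lt_mul hj4]; rw [pow_succ] at he'; omega
  have h2 : 16 ≤ e / 2 ^ (j - 4) := by
    rw [Nat.le_div_iff_mul_le hj4]; omega
  have h3 := List.all_eq_true.1 zeros_window (e / 2 ^ (j - 4) - 16) (by rw [List.mem_range]; omega)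
  have h4 := List.all_eq_true.1 h3 (u % 32 / 2) (by rw [List.mem_range]; omega)
  rw [show 16 + (e / 2 ^ (j - 4) - 16) = e / 2 ^ (j - 4) by omega,
    show 2 * (u % 32 / 2) + 1 = u % 32 by omega] at h4
  rw [Bool.or_eq_true, Bool.and_eq_true, beq_iff, beq_iff] at h4
  rcases h4 with h4 | h4
  · omega
  · exfalso
    obtain ⟨x, hx, hc⟩ := List.any_eq_true.1 h4
    rw [List.mem_range] at hx
    refine inconsistent_sound hc (n := x * u) (by
      rw [show (2 : ℕ) ^ (4 + 1) = 32 by norm_num, Nat.mul_mod_mod]) ?_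
    intro c hc
    rw [zerosConstraints, List.mem_cons] at hc
    rcases hc with rfl | hc
    · have := h.zeros_step hK he' (by omega) hu hv (x := x) (y := 0) (by omega) (by omega)
      simp only [zero_mul, Nat.zero_div, add_zero, r_zero, r_two_mul] at this
      have := r_lt_two (x * u)
      have := r_lt_two x
      rw [eval_toNat, r_two_mul, add_zero]
      omega
    · simp only [List.mem_filterMap, List.mem_range] at hc
      obtain ⟨i, hi, hc⟩ := hc
      by_cases heq : (i + 1) * (e / 2 ^ (j - 4)) / 2 ^ 3 =
          ((i + 1) * (e / 2 ^ (j - 4) + 1) - 1) / 2 ^ 3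
      · rw [beq_iff.2 heq, cond_true, Option.some_inj] at hc
        subst hc
        have hd := div_eq_of_leading rfl heq (by omega)
        rw [show j - 4 + 3 = j - 1 by omega] at hd
        have := h.zeros_step hK he' (by omega) hu hv (x := x) (y := i + 1) (by omega) (by omega)
        rw [hd] at this
        have := r_lt_two (x * u + (i + 1))
        dsimp only
        rw [xor_toNat, xor_toNat, eval_toNat, eval_toNat, eval_toNat]
        omega
      · rw [Bool.eq_false_iff.2 (fun hb => heq (beq_iff.1 hb))] at hc
        simp at hc

/-- Take x = 2^v + 1. As u ≡ 1 mod 32, the low part of 2xd is 2^(v+2) + 2, while the cut of d is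
2^(v+3) + 8. Adding them puts 2^(v+3) next to 2^(v+2), which creates exactly one block 11. -/
theorem Monochromatic.zeros_false {d j u v e : ℕ} (h : Monochromatic d)
    (hK : d = 2 ^ (j + v) + e) (he : 2 ^ j ≤ e) (he' : e < 2 ^ (j + 1)) (hj : 7 ≤ j)
    (hu : d = u * 2 ^ v + 1) (hodd : u % 2 = 1) (hv : 7 ≤ v) : False := by
  obtain ⟨hT, hL⟩ := h.zeros_ends hK he he' hj hu hodd hv
  obtain ⟨w, rfl⟩ : ∃ w, v = w + 5 := ⟨v - 5, by omega⟩
  obtain ⟨i, rfl⟩ : ∃ i, j = i + 4 := ⟨j - 4, by omega⟩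
  rw [Nat.add_sub_cancel] at hT
  have hi : 0 < 2 ^ i := by positivity
  have hw : 4 ≤ 2 ^ w := by
    calc 4 = 2 ^ 2 := by norm_num
      _ ≤ 2 ^ w := Nat.pow_le_pow_right (by norm_num) (by omega)
  have hd : d = 512 * (2 ^ i * 2 ^ w) + e := by rw [hK]; ring
  have hiw : 4 * 2 ^ i ≤ 2 ^ i * 2 ^ w := by
    rw [mul_comm 4]; exact Nat.mul_le_mul_left _ hw
  have hwi : 2 ^ w ≤ 2 ^ i * 2 ^ w := Nat.le_mul_of_pos_left _ hi
  have hA : 1 * d / 2 ^ (i + 1) = 2 ^ (w + 8) + 8 := by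
    have e1 : d = e + 2 ^ (w + 8) * 2 ^ (i + 1) := by rw [hd]; ring
    rw [one_mul, e1, Nat.add_mul_div_right _ _ (by positivity), pow_succ, ← Nat.div_div_eq_div_mul,
      hT, add_comm]
  have hs := h.shift (2 ^ (w + 5) + 1) 1 (i + 1) (by
    have : (2 ^ (w + 5) + 1) * 2 ^ (i + 1 + 1) = 128 * (2 ^ i * 2 ^ w) + 4 * 2 ^ i := by ring
    rw [this, hd]
    omega)
  have h0 : r (2 * ((2 ^ (w + 5) + 1) * d)) = 0 := by
    rw [r_two_mul]
    apply h
    rw [show 2 ^ (w + 5) = 32 * 2 ^ w by ring, hd]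
    omega
  obtain ⟨q, hq⟩ : ∃ q, u = 1 + 32 * q := ⟨u / 32, by omega⟩
  have e2 : 2 * ((2 ^ (w + 5) + 1) * d) = (q + 2 ^ w * u) * 2 ^ (w + 10 + 1) + (2 ^ (w + 7) + 2) := by
    rw [hu, hq]; ring
  have p10 : 2 ^ (w + 10) = 1024 * 2 ^ w := by ring
  have p7 : 2 ^ (w + 7) = 128 * 2 ^ w := by ring
  have p8 : 2 ^ (w + 8) = 256 * 2 ^ w := by ring
  have e3 : 2 ^ (w + 7) + 2 + (2 ^ (w + 8) + 8) = 3 * 2 ^ (w + 6 + 1) + 10 := by ring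
  have p6 : 2 ^ (w + 6) = 64 * 2 ^ w := by ring
  have r10 : r 10 = 0 := by decide
  have r8 : r 8 = 0 := by decide
  have r2 : r 2 = 0 := by decide
  have r3 : r 3 = 1 := by decide
  rw [e2, r_concat_of_lt _ _ _ (by omega), r_two_pow_add _ _ (by omega), r2] at h0
  rw [hA, e2, add_assoc, r_concat_of_lt _ _ _ (by omega), e3, r_concat_of_lt _ _ _ (by omega),
    r_two_pow_add _ _ (by omega), r10, r8, r3] at hs
  omega

theorem Monochromatic.eq_two_pow_add_one {d K : ℕ} (h : Monochromatic d) (hK : 9 ≤ K)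
    (hT : d / 2 ^ (K - 6) = 64) (hL : d % 2 ^ 7 = 1) : d = 2 ^ K + 1 := by
  by_contra hne
  have eK : 2 ^ K = 64 * 2 ^ (K - 6) := by
    rw [show (64 : ℕ) = 2 ^ 6 by norm_num, ← pow_add]; congr 1; omega
  have hK0 : 0 < 2 ^ (K - 6) := by positivity
  have h1 := Nat.div_add_mod d (2 ^ (K - 6))
  have h2 := Nat.mod_lt d hK0
  rw [hT, mul_comm, ← eK] at h1
  set e := d % 2 ^ (K - 6)
  norm_num at hL
  have hKe : 2 ^ K % 2 = 0 := by
    rw [show K = K - 1 + 1 by omega, pow_succ]; omega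
  have hK7 : 512 ≤ 2 ^ K := by
    calc 512 = 2 ^ 9 := by norm_num
      _ ≤ 2 ^ K := Nat.pow_le_pow_right (by norm_num) hK
  have he2 : 2 ≤ e := by omega
  obtain ⟨v, u, hodd, hu⟩ := Nat.exists_eq_two_pow_mul_odd (n := d - 1) (by omega)
  rw [Nat.odd_iff] at hodd
  have hu' : d = u * 2 ^ v + 1 := by rw [mul_comm, ← hu]; omega
  have hv : 7 ≤ v := by
    by_contra hlt
    have h128 : 128 ∣ 2 ^ v * u := by rw [← hu]; omega
    have h3 : 2 ^ 7 = 2 ^ v * 2 ^ (7 - v) := by rw [← pow_add]; congr 1; omega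
    have h4 : 2 ^ v * 2 ^ (7 - v) ∣ 2 ^ v * u := by rw [← h3]; exact h128
    have h5 := Nat.dvd_of_mul_dvd_mul_left (by positivity) h4
    rw [show 7 - v = 6 - v + 1 by omega, pow_succ] at h5
    have h6 := (Nat.dvd_mul_left 2 (2 ^ (6 - v))).trans h5
    omega
  have hj : 2 ^ (Nat.log 2 e) ≤ e := Nat.pow_log_le_self 2 (by omega)
  have hj' : e < 2 ^ (Nat.log 2 e + 1) := Nat.lt_pow_succ_log_self (by norm_num) e
  set j := Nat.log 2 e
  have hjK : j + 7 ≤ K := by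
    have : 2 ^ j < 2 ^ (K - 6) := hj.trans_lt h2
    have := (Nat.pow_lt_pow_iff_right (by norm_num : 1 < 2)).1 this
    omega
  have hvK : v ≤ K := by
    by_contra hlt
    have h3 : 2 ^ (K + 1) ≤ 2 ^ v := Nat.pow_le_pow_right (by norm_num) (by omega)
    have h4 : 2 ^ v ≤ u * 2 ^ v := Nat.le_mul_of_pos_left _ (by omega)
    rw [pow_succ] at h3
    omega
  have hb := h.zeros_balanced h1.symm hj hj' hjK hu' hodd hv hvK
  rw [← hb] at h1
  -- Balance gives e = (u - 2^j)·2^v + 1 with u > 2^j, hence v ≤ j.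
  have hvj : 7 ≤ j := by
    have h3 : 2 ^ j * 2 ^ v + e = u * 2 ^ v + 1 := by rw [← pow_add, h1, hu']
    have h4 : 2 ^ j < u := by
      have : 2 ^ j * 2 ^ v < u * 2 ^ v := by omega
      exact Nat.lt_of_mul_lt_mul_right this
    have h5 : (2 ^ j + 1) * 2 ^ v ≤ u * 2 ^ v := Nat.mul_le_mul_right _ h4
    have h6 : 2 ^ v < 2 ^ (j + 1) := by rw [add_mul] at h5; omega
    have := (Nat.pow_lt_pow_iff_right (by norm_num : 1 < 2)).1 h6
    omega
  exact h.zeros_false h1.symm hj hj' hvj hu' hodd hv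

/-! ### The shape 1…1 -/

theorem r_two_pow_sub (m c : ℕ) (hc : c < 2 ^ m) :
    r (2 ^ (m + 1) - 1 - c) = (m + c + r c) % 2 := by
  simpa using r_complement 0 m c hc

/-- A number `2 ^ N - e = u * 2 ^ v - 1` with `2 ^ j < e < 2 ^ (j + 1)` can only be monochromatic
if it has as many leading as trailing ones. -/
theorem Monochromatic.ones_balanced {d N j u v e : ℕ} (h : Monochromatic d)
    (hN : d + e = 2 ^ N) (he : 2 ^ j < e) (he' : e < 2 ^ (j + 1)) (hj : j + 8 ≤ N)
    (hu : d + 1 = u * 2 ^ v) (hodd : u % 2 = 1) (hv : 7 ≤ v) (hvN : v + 1 ≤ N) :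
    j + 1 + v = N := by
  have hN2 : 256 * 2 ^ j ≤ 2 ^ N := by
    calc 256 * 2 ^ j = 2 ^ (j + 8) := by rw [pow_add]; ring
      _ ≤ 2 ^ N := Nat.pow_le_pow_right (by norm_num) hj
  have hj0 : 0 < 2 ^ j := by positivity
  have hv2 : 128 ≤ 2 ^ v := by
    calc 128 = 2 ^ 7 := by norm_num
      _ ≤ 2 ^ v := Nat.pow_le_pow_right (by norm_num) (by omega)
  have e1 : 2 ^ (v + 1) = 2 * 2 ^ v := by ring
  have e2 : 2 ^ (j + 1) = 2 * 2 ^ j := by ring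
  have h2d : 2 * (1 * d) + 2 = u * 2 ^ (v + 1) := by rw [e1]; linarith
  -- the value of `d / 2 ^ M` when the cut lies within the leading ones
  have hcut : ∀ i, i + j + 1 ≤ N → 1 * d / 2 ^ (N - i) = 2 ^ i - 1 := by
    intro i hi
    have e3 : 2 ^ N = 2 ^ i * 2 ^ (N - i) := by rw [← pow_add]; congr 1; omega
    have e4 : 2 ^ (j + 1) ≤ 2 ^ (N - i) := Nat.pow_le_pow_right (by norm_num) (by omega)
    have hi0 : 0 < 2 ^ i := by positivity
    rw [one_mul]
    apply Nat.div_eq_of_lt_le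
    · rw [Nat.sub_mul, ← e3]; omega
    · rw [show 2 ^ i - 1 + 1 = 2 ^ i by omega, ← e3]; omega
  have hbound : ∀ M, M + 3 ≤ N → 2 * (1 * 2 ^ (M + 1) + 1) < d := by
    intro M hM
    have : 4 * 2 ^ (M + 1) ≤ 2 ^ N := by
      calc 4 * 2 ^ (M + 1) = 2 ^ (M + 3) := by ring
        _ ≤ 2 ^ N := Nat.pow_le_pow_right (by norm_num) hM
    omega
  have hru : r u = 0 := by
    have hs := h.shift 1 1 (N - 3) (hbound _ (by omega))
    rw [hcut 3 (by omega), show 2 * (1 * d) + (2 ^ 3 - 1) = u * 2 ^ (v + 1) + 5 by omega,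
      r_concat_of_lt _ _ _ (by omega), show r 5 = 0 by decide,
      show r (2 ^ 3 - 1) = 0 by decide] at hs
    have := r_lt_two u
    omega
  rcases lt_trichotomy (j + 1 + v) N with hlt | heq | hgt
  -- The cut is v + 1 ones. In the sum they become 1…101, which loses two pairs and gains one at the
  -- junction with u.
  · have hs := h.shift 1 1 (N - (v + 1)) (hbound _ (by omega))
    rw [hcut _ (by omega), show 2 * (1 * d) + (2 ^ (v + 1) - 1) =
      u * 2 ^ (v + 1) + (2 ^ (v + 1) - 1 - 2) by omega, r_concat_of_le _ _ _ (by omega) (by omega),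
      r_two_pow_sub v 2 (by omega), ← Nat.sub_zero (2 ^ (v + 1) - 1),
      r_two_pow_sub v 0 (by omega), show r 2 = 0 by decide, r_zero, hru] at hs
    omega
  · exact heq
  -- Here p < v is the number of leading ones. The cut is p ones and a 0; in the sum one of these
  -- ones disappears, with no new pair at u.
  · obtain ⟨p, hp⟩ : ∃ p, N = p + j + 1 := ⟨N - j - 1, by omega⟩
    have hp1 : 2 ^ (p + 1) ≤ 2 ^ v := Nat.pow_le_pow_right (by norm_num) (by omega)
    have hp2 : 128 ≤ 2 ^ p := by
      calc 128 = 2 ^ 7 := by norm_num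
        _ ≤ 2 ^ p := Nat.pow_le_pow_right (by norm_num) (by omega)
    have e3 : 2 ^ (p + 1) = 2 * 2 ^ p := by ring
    have hA : 1 * d / 2 ^ j = 2 ^ (p + 1) - 1 - 1 := by
      have e4 : 2 ^ N = 2 ^ (p + 1) * 2 ^ j := by rw [hp]; ring
      rw [one_mul]
      apply Nat.div_eq_of_lt_le
      · rw [Nat.sub_sub, Nat.sub_mul, ← e4]; omega
      · rw [show 2 ^ (p + 1) - 1 - 1 + 1 = 2 ^ (p + 1) - 1 by omega, Nat.sub_mul, ← e4]; omega
    have hs := h.shift 1 1 j (hbound _ (by omega))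
    rw [hA, show 2 * (1 * d) + (2 ^ (p + 1) - 1 - 1) =
      u * 2 ^ (v + 1) + (2 ^ (p + 1) - 1 - 3) by omega, r_concat_of_lt _ _ _ (by omega),
      r_two_pow_sub p 3 (by omega), r_two_pow_sub p 1 (by omega), show r 3 = 1 by decide,
      show r 1 = 0 by decide, hru] at hs
    omega

/-- Both summands lie just below multiples of 2^(v+1), so their low parts are complements of small
numbers and `r_complement` replaces the splitting used for zeros. The extra x is the parity of xu.
-/
theorem Monochromatic.ones_step {d j u v e x y : ℕ} (h : Monochromatic d)
    (hN : d + e = 2 ^ (j + 1 + v)) (he : 2 ^ j < e) (he' : e < 2 ^ (j + 1)) (hj : 1 ≤ j)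
    (hu : d + 1 = u * 2 ^ v) (hodd : u % 2 = 1) (hv : 7 ≤ v) (hx : x ≤ 7) (hy : y ≤ 15) :
    (r (x * u + y) + x + r (2 * x + ((y + 1) * e - 1) / 2 ^ j)) % 2 =
      (r y + r (((y + 1) * e - 1) / 2 ^ j)) % 2 := by
  have hj0 : 0 < 2 ^ j := by positivity
  have hj2 : 2 ≤ 2 ^ j := by
    calc 2 = 2 ^ 1 := by norm_num
      _ ≤ 2 ^ j := Nat.pow_le_pow_right (by norm_num) hj
  have hv2 : 128 ≤ 2 ^ v := by
    calc 128 = 2 ^ 7 := by norm_num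
      _ ≤ 2 ^ v := Nat.pow_le_pow_right (by norm_num) (by omega)
  have e1 : 2 ^ (v + 1) = 2 * 2 ^ v := by ring
  have e2 : 2 ^ (j + 1) = 2 * 2 ^ j := by ring
  have hye : (y + 1) * e ≤ 16 * e := Nat.mul_le_mul_right _ (by omega)
  have hye0 : 0 < (y + 1) * e := Nat.mul_pos (by omega) (by omega)
  have hG : ((y + 1) * e - 1) / 2 ^ j < 32 := by
    rw [Nat.div_lt_iff_lt_mul hj0]
    omega
  have hdm := Nat.div_add_mod ((y + 1) * e - 1) (2 ^ j)
  have hml := Nat.mod_lt ((y + 1) * e - 1) hj0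
  set G := ((y + 1) * e - 1) / 2 ^ j
  have hA : (y + 1) * d / 2 ^ j = y * 2 ^ (v + 1) + (2 ^ (v + 1) - 1 - G) := by
    have h1 : (y + 1) * d + (y + 1) * e = (y * 2 ^ (v + 1) + 2 ^ (v + 1)) * 2 ^ j := by
      rw [← mul_add, hN]; ring
    have h2 : (y * 2 ^ (v + 1) + (2 ^ (v + 1) - 1 - G)) * 2 ^ j + (1 + G) * 2 ^ j =
        (y * 2 ^ (v + 1) + 2 ^ (v + 1)) * 2 ^ j := by
      rw [← add_mul]; congr 1; omega
    have h3 : (1 + G) * 2 ^ j = 2 ^ j + 2 ^ j * G := by ring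
    apply Nat.div_eq_of_lt_le
    · omega
    · rw [add_mul (y * 2 ^ (v + 1) + (2 ^ (v + 1) - 1 - G)) 1]; omega
  have hs := h.shift x (y + 1) j (by
    have h1 : x * 2 ^ (j + 1) ≤ 7 * 2 ^ (j + 1) := Nat.mul_le_mul_right _ hx
    have h2 : 128 * 2 ^ (j + 1) ≤ 2 ^ (j + 1 + v) := by
      rw [pow_add _ _ v, mul_comm]
      exact Nat.mul_le_mul_left _ hv2
    omega)
  have h3 : 2 * (x * d) + (y * 2 ^ (v + 1) + (2 ^ (v + 1) - 1 - G)) =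
      (x * u + y) * 2 ^ (v + 1) + (2 ^ (v + 1) - 1 - (2 * x + G)) := by
    have : 2 * (x * d) + 2 * x = x * u * 2 ^ (v + 1) := by
      calc 2 * (x * d) + 2 * x = 2 * x * (d + 1) := by ring
        _ = x * u * 2 ^ (v + 1) := by rw [hu]; ring
    rw [add_mul (x * u)]
    omega
  have hxu : (x * u) % 2 = x % 2 := by rw [Nat.mul_mod, hodd, mul_one, Nat.mod_mod]
  rw [hA, h3, r_complement _ _ _ (by omega), r_complement _ _ _ (by omega)] at hs
  omega

/-- The instances of `Monochromatic.ones_step` determined by the leading digits `T` of `e`. -/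
def onesConstraints (T x : ℕ) : List (ℕ × Bool) :=
  (List.range 16).filterMap fun y =>
    bif Nat.beq ((y + 1) * T / 2 ^ 4) (((y + 1) * (T + 1) - 1) / 2 ^ 4) then
      some (y, (eval (2 * x + (y + 1) * T / 2 ^ 4) ^^ Nat.beq (x % 2) 1) ^^
        (eval y ^^ eval ((y + 1) * T / 2 ^ 4)))
    else none

theorem ones_window : ((List.range 16).all fun t => (List.range 16).all fun l =>
    (Nat.ble 14 t && Nat.beq l 0) || (List.range 8).any fun x =>
      inconsistent (2 ^ 4) (x * (2 * l + 1) % 2 ^ 5) (onesConstraints (16 + t) x)) = true := by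
  decide +kernel

theorem Monochromatic.ones_ends {d j u v e : ℕ} (h : Monochromatic d)
    (hN : d + e = 2 ^ (j + 1 + v)) (he : 2 ^ j < e) (he' : e < 2 ^ (j + 1)) (heo : e % 2 = 1)
    (hj : 7 ≤ j) (hu : d + 1 = u * 2 ^ v) (hodd : u % 2 = 1) (hv : 7 ≤ v) :
    30 ≤ e / 2 ^ (j - 4) ∧ u % 32 = 1 := by
  have hj4 : 0 < 2 ^ (j - 4) := by positivity
  have ej : 2 ^ j = 16 * 2 ^ (j - 4) := by
    rw [show (16 : ℕ) = 2 ^ 4 by norm_num, ← pow_add]; congr 1; omega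
  have h1 : e / 2 ^ (j - 4) < 32 := by
    rw [Nat.div_lt_iff_lt_mul hj4]; rw [pow_succ] at he'; omega
  have h2 : 16 ≤ e / 2 ^ (j - 4) := by
    rw [Nat.le_div_iff_mul_le hj4]; omega
  have h3 := List.all_eq_true.1 ones_window (e / 2 ^ (j - 4) - 16) (by rw [List.mem_range]; omega)
  have h4 := List.all_eq_true.1 h3 (u % 32 / 2) (by rw [List.mem_range]; omega)
  rw [show 16 + (e / 2 ^ (j - 4) - 16) = e / 2 ^ (j - 4) by omega,
    show 2 * (u % 32 / 2) + 1 = u % 32 by omega] at h4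
  rw [Bool.or_eq_true, Bool.and_eq_true, beq_iff, Nat.ble_eq] at h4
  rcases h4 with h4 | h4
  · omega
  · exfalso
    obtain ⟨x, hx, hc⟩ := List.any_eq_true.1 h4
    rw [List.mem_range] at hx
    refine inconsistent_sound hc (n := x * u) (by
      rw [show (2 : ℕ) ^ (4 + 1) = 32 by norm_num, Nat.mul_mod_mod]) ?_
    intro c hc
    simp only [onesConstraints, List.mem_filterMap, List.mem_range] at hc
    obtain ⟨y, hy, hc⟩ := hc
    by_cases heq : (y + 1) * (e / 2 ^ (j - 4)) / 2 ^ 4 =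
        ((y + 1) * (e / 2 ^ (j - 4) + 1) - 1) / 2 ^ 4
    · rw [beq_iff.2 heq, cond_true, Option.some_inj] at hc
      subst hc
      -- Strict because e is odd; this makes up for the -1 in (y+1)e - 1.
      have hlt : e / 2 ^ (j - 4) * 2 ^ (j - 4) < e := by
        apply lt_of_le_of_ne (leading_bounds _ _).1
        rw [show j - 4 = j - 5 + 1 by omega, pow_succ, ← mul_assoc]
        omega
      have hd := div_eq_of_between (n := (y + 1) * e - 1) (t := j - 4) (by
          have := Nat.mul_lt_mul_of_pos_left hlt (show 0 < y + 1 by omega)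
          rw [← mul_assoc] at this
          omega) (by
          have := Nat.mul_lt_mul_of_pos_left (leading_bounds e (j - 4)).2 (show 0 < y + 1 by omega)
          rw [← mul_assoc] at this
          omega) heq
      rw [show j - 4 + 4 = j by omega] at hd
      have := h.ones_step hN he he' (by omega) hu hodd hv (x := x) (y := y) (by omega) (by omega)
      rw [hd] at this
      have := r_lt_two (x * u + y)
      have hb : (Nat.beq (x % 2) 1).toNat = x % 2 := by
        rcases Nat.mod_two_eq_zero_or_one x with h | h <;> rw [h] <;> rfl
      dsimp only
      rw [xor_toNat, xor_toNat, xor_toNat, eval_toNat, eval_toNat, eval_toNat, hb]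
      omega
    · rw [Bool.eq_false_iff.2 (fun hb => heq (beq_iff.1 hb))] at hc
      simp at hc

/-- With x = 2^v - 1, 2xd = R·2^(v+6) - 2^(v+2) + 2. The cuts at j - 2 and j - 3 force opposite
values of r(R). -/
theorem Monochromatic.ones_false {d j u v e : ℕ} (h : Monochromatic d)
    (hN : d + e = 2 ^ (j + 1 + v)) (he : 2 ^ j < e) (he' : e < 2 ^ (j + 1)) (heo : e % 2 = 1)
    (hj : 7 ≤ j) (hu : d + 1 = u * 2 ^ v) (hodd : u % 2 = 1) (hv : 7 ≤ v) : False := by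
  obtain ⟨hT, hL⟩ := h.ones_ends hN he he' heo hj hu hodd hv
  obtain ⟨w, rfl⟩ : ∃ w, v = w + 5 := ⟨v - 5, by omega⟩
  obtain ⟨i, rfl⟩ : ∃ i, j = i + 4 := ⟨j - 4, by omega⟩
  rw [Nat.add_sub_cancel] at hT
  have hi : 0 < 2 ^ i := by positivity
  have hw : 4 ≤ 2 ^ w := by
    calc 4 = 2 ^ 2 := by norm_num
      _ ≤ 2 ^ w := Nat.pow_le_pow_right (by norm_num) (by omega)
  have hd : d + e = 1024 * (2 ^ i * 2 ^ w) := by rw [hN]; ring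
  have hiw : 4 * 2 ^ i ≤ 2 ^ i * 2 ^ w := by
    rw [mul_comm 4]; exact Nat.mul_le_mul_left _ hw
  have hwi : 2 ^ w ≤ 2 ^ i * 2 ^ w := Nat.le_mul_of_pos_left _ hi
  have he1 : 30 * 2 ^ i ≤ e := (Nat.le_div_iff_mul_le hi).1 hT
  have he2 : e < 32 * 2 ^ i := by rw [show 32 * 2 ^ i = 2 ^ (i + 4 + 1) by ring]; exact he'
  have hx : (2 ^ (w + 5) - 1) * 2 ^ (i + 3) + 8 * 2 ^ i = 256 * (2 ^ i * 2 ^ w) := by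
    rw [show 8 * 2 ^ i = 1 * 2 ^ (i + 3) by ring, ← add_mul,
      Nat.sub_add_cancel Nat.one_le_two_pow]
    ring
  have hx' : (2 ^ (w + 5) - 1) * 2 ^ (i + 2) + 4 * 2 ^ i = 128 * (2 ^ i * 2 ^ w) := by
    rw [show 4 * 2 ^ i = 1 * 2 ^ (i + 2) by ring, ← add_mul,
      Nat.sub_add_cancel Nat.one_le_two_pow]
    ring
  have p5 : 2 ^ (w + 5) = 32 * 2 ^ w := by ring
  have p6 : 2 ^ (w + 6) = 64 * 2 ^ w := by ring
  have p7 : 2 ^ (w + 7) = 128 * 2 ^ w := by ring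
  have p8 : 2 ^ (w + 8) = 256 * 2 ^ w := by ring
  have p9 : 2 ^ (w + 9) = 512 * 2 ^ w := by ring
  have p10 : 2 ^ (w + 10) = 1024 * 2 ^ w := by ring
  have hA3 : 1 * d / 2 ^ (i + 2) = 2 ^ (w + 7 + 1) - 1 - 7 := by
    have e4 : 2 ^ (w + 8) * 2 ^ (i + 2) = 1024 * (2 ^ i * 2 ^ w) := by ring
    have e5 : 2 ^ (i + 2) = 4 * 2 ^ i := by ring
    rw [one_mul]
    apply Nat.div_eq_of_lt_le
    · rw [Nat.sub_sub, Nat.sub_mul, e4]; omega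
    · rw [show 2 ^ (w + 7 + 1) - 1 - 7 + 1 = 2 ^ (w + 8) - 7 by omega, Nat.sub_mul, e4]; omega
  have hA4 : 1 * d / 2 ^ (i + 1) = 2 ^ (w + 8 + 1) - 1 - 15 := by
    have e4 : 2 ^ (w + 9) * 2 ^ (i + 1) = 1024 * (2 ^ i * 2 ^ w) := by ring
    have e5 : 2 ^ (i + 1) = 2 * 2 ^ i := by ring
    -- At equality the cut would be larger by one; parity of e rules this out.
    have hne : e ≠ 30 * 2 ^ i := by omega
    rw [one_mul]
    apply Nat.div_eq_of_lt_le
    · rw [Nat.sub_sub, Nat.sub_mul, e4]; omega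
    · rw [show 2 ^ (w + 8 + 1) - 1 - 15 + 1 = 2 ^ (w + 9) - 15 by omega, Nat.sub_mul, e4]; omega
  have hs3 := h.shift (2 ^ (w + 5) - 1) 1 (i + 2) (by
    rw [show i + 2 + 1 = i + 3 by ring]; omega)
  have hs4 := h.shift (2 ^ (w + 5) - 1) 1 (i + 1) (by
    rw [show i + 1 + 1 = i + 2 by ring]; omega)
  obtain ⟨q, hq⟩ : ∃ q, u = 1 + 32 * q := ⟨u / 32, by omega⟩
  obtain ⟨R, hR⟩ : ∃ R, 2 * ((2 ^ (w + 5) - 1) * d) + 2 ^ (w + 7) = R * 2 ^ (w + 10 + 1) + 2 := by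
    obtain ⟨s, hs⟩ : ∃ s, 2 ^ (w + 5) = s + 1 := ⟨2 ^ (w + 5) - 1, by omega⟩
    refine ⟨2 ^ w + q * s, ?_⟩
    have e7 : 2 ^ (w + 7) = 4 * (s + 1) := by rw [← hs]; ring
    have e11 : 2 ^ (w + 10 + 1) = 64 * (s + 1) := by rw [← hs]; ring
    have hws : 32 * 2 ^ w = s + 1 := by rw [← hs]; ring
    have hd' : d = s + 32 * q * (s + 1) := by
      rw [hq, hs] at hu
      linarith
    rw [hs, e7, e11, Nat.add_sub_cancel, hd', add_mul (2 ^ w),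
      show 2 ^ w * (64 * (s + 1)) = 2 * (32 * 2 ^ w) * (s + 1) by ring, hws]
    ring
  rw [hA3, show 2 * ((2 ^ (w + 5) - 1) * d) + (2 ^ (w + 7 + 1) - 1 - 7) =
    R * 2 ^ (w + 10 + 1) + (2 ^ (w + 6 + 1) - 1 - 5) by omega, r_concat_of_lt _ _ _ (by omega),
    r_two_pow_sub _ _ (by omega), r_two_pow_sub _ _ (by omega), show r 5 = 0 by decide,
    show r 7 = 0 by decide] at hs3
  rw [hA4, show 2 * ((2 ^ (w + 5) - 1) * d) + (2 ^ (w + 8 + 1) - 1 - 15) =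
    R * 2 ^ (w + 10 + 1) + (2 ^ (w + 8) + (2 ^ (w + 6 + 1) - 1 - 13)) by omega,
    r_concat_of_lt _ _ _ (by omega), r_two_pow_add _ _ (by omega),
    r_two_pow_sub _ _ (by omega), r_two_pow_sub _ _ (by omega), show r 13 = 1 by decide,
    show r 15 = 1 by decide] at hs4
  omega

theorem Monochromatic.eq_two_pow_sub_one {d N : ℕ} (h : Monochromatic d) (hN : 10 ≤ N)
    (hT : d / 2 ^ (N - 7) = 127) (hL : d % 2 ^ 7 = 127) : d = 2 ^ N - 1 := by
  by_contra hne
  have eN : 2 ^ N = 128 * 2 ^ (N - 7) := by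
    rw [show (128 : ℕ) = 2 ^ 7 by norm_num, ← pow_add]; congr 1; omega
  have hN0 : 0 < 2 ^ (N - 7) := by positivity
  obtain ⟨h1, h2⟩ := leading_bounds d (N - 7)
  rw [hT] at h1 h2
  norm_num at hL
  have hN7 : 1024 ≤ 2 ^ N := by
    calc 1024 = 2 ^ 10 := by norm_num
      _ ≤ 2 ^ N := Nat.pow_le_pow_right (by norm_num) hN
  obtain ⟨e, he⟩ : ∃ e, d + e = 2 ^ N := ⟨2 ^ N - d, by omega⟩
  have hNe : 2 ^ N % 2 = 0 := by
    rw [show N = N - 1 + 1 by omega, pow_succ]; omega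
  have hTe : 2 ^ (N - 7) % 2 = 0 := by
    rw [show N - 7 = N - 8 + 1 by omega, pow_succ]; omega
  have he2 : 2 ≤ e := by omega
  have heo : e % 2 = 1 := by omega
  obtain ⟨v, u, hodd, hu⟩ := Nat.exists_eq_two_pow_mul_odd (n := d + 1) (by omega)
  rw [Nat.odd_iff] at hodd
  rw [mul_comm] at hu
  have hv : 7 ≤ v := by
    by_contra hlt
    have h128 : 128 ∣ 2 ^ v * u := by rw [mul_comm, ← hu]; omega
    have h3 : 2 ^ 7 = 2 ^ v * 2 ^ (7 - v) := by rw [← pow_add]; congr 1; omega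
    have h4 : 2 ^ v * 2 ^ (7 - v) ∣ 2 ^ v * u := by rw [← h3]; exact h128
    have h5 := Nat.dvd_of_mul_dvd_mul_left (by positivity) h4
    rw [show 7 - v = 6 - v + 1 by omega, pow_succ] at h5
    have h6 := (Nat.dvd_mul_left 2 (2 ^ (6 - v))).trans h5
    omega
  have hj : 2 ^ (Nat.log 2 e) ≤ e := Nat.pow_log_le_self 2 (by omega)
  have hj' : e < 2 ^ (Nat.log 2 e + 1) := Nat.lt_pow_succ_log_self (by norm_num) e
  have hj1 : 1 ≤ Nat.log 2 e := Nat.log_pos (by norm_num) he2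
  set j := Nat.log 2 e
  have hje : 2 ^ j % 2 = 0 := by
    rw [show j = j - 1 + 1 by omega, pow_succ]; omega
  have hj2 : 2 ^ j < e := by omega
  have hjN : j + 8 ≤ N := by
    have : 2 ^ j < 2 ^ (N - 7) := by omega
    have := (Nat.pow_lt_pow_iff_right (by norm_num : 1 < 2)).1 this
    omega
  have hvN : v + 1 ≤ N := by
    by_contra hlt
    have h3 : 2 ^ N ≤ 2 ^ v := Nat.pow_le_pow_right (by norm_num) (by omega)
    have h4 : 2 ^ v ≤ u * 2 ^ v := Nat.le_mul_of_pos_left _ (by omega)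
    omega
  have hb := h.ones_balanced he hj2 hj' hjN hu hodd hv hvN
  rw [← hb] at he
  have hvj : 7 ≤ j := by
    have h3 : 2 ^ (j + 1) * 2 ^ v + 1 = u * 2 ^ v + e := by rw [← pow_add, ← he, ← hu]; ring
    have h4 : u < 2 ^ (j + 1) := by
      have : u * 2 ^ v < 2 ^ (j + 1) * 2 ^ v := by omega
      exact Nat.lt_of_mul_lt_mul_right this
    have h5 : (u + 1) * 2 ^ v ≤ 2 ^ (j + 1) * 2 ^ v := Nat.mul_le_mul_right _ h4
    have h6 : 2 ^ v < 2 ^ (j + 1) := by rw [add_mul] at h5; omega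
    have := (Nat.pow_lt_pow_iff_right (by norm_num : 1 < 2)).1 h6
    omega
  exact h.ones_false he hj2 hj' heo hvj hu hodd hv

/-! ### Classification of odd monochromatic differences -/

theorem Monochromatic.eq_two_pow_add_or_sub_one {d : ℕ} (h : Monochromatic d) (hodd : d % 2 = 1)
    (hd : 512 ≤ d) : (∃ K, 9 ≤ K ∧ d = 2 ^ K + 1) ∨ ∃ N, 3 ≤ N ∧ Odd N ∧ d = 2 ^ N - 1 := by
  have h1 : 2 ^ Nat.log 2 d ≤ d := Nat.pow_log_le_self 2 (by omega)
  have h2 : d < 2 ^ (Nat.log 2 d + 1) := Nat.lt_pow_succ_log_self (by norm_num) d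
  have h3 : 9 ≤ Nat.log 2 d := Nat.le_log_of_pow_le (by norm_num) (by omega)
  set K := Nat.log 2 d
  rcases h.ends (k := K + 1) hodd (by simpa using h1) h2 (by omega) with ⟨ha, hb⟩ | ⟨ha, hb⟩
  · refine Or.inl ⟨K, h3, h.eq_two_pow_add_one h3 ?_ hb⟩
    rwa [show K + 1 - 7 = K - 6 by omega] at ha
  · have e := h.eq_two_pow_sub_one (by omega) ha hb
    refine Or.inr ⟨K + 1, by omega, ?_, e⟩
    have h0 := h.r_self (by omega)
    have hK : 0 < 2 ^ K := by positivity
    -- A run of K + 1 ones contains K blocks 11, so r(d) = 0 makes K even.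
    rw [e, ← Nat.sub_zero (2 ^ (K + 1) - 1), r_two_pow_sub K 0 hK, r_zero] at h0
    rw [Nat.odd_iff]
    omega

/-- Searches `fuel` many `l`, from the given one on, for `2 * l < d` with value `1` at `l * d`. -/
def findOdd : ℕ → ℕ → ℕ → Bool
  | 0, _, _ => false
  | f + 1, d, l => Nat.blt (2 * l) d && (eval (l * d) || findOdd f d (l + 1))

theorem findOdd_sound (f d l : ℕ) (hf : findOdd f d l = true) : ¬ Monochromatic d := by
  induction f generalizing l with
  | zero => simp [findOdd] at hf
  | succ f ih =>
    rw [findOdd, Bool.and_eq_true, Bool.or_eq_true, blt_iff] at hf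
    rcases hf.2 with h | h
    · intro hm
      have := hm l hf.1
      rw [← eval_toNat, h] at this
      simp at this
    · exact ih _ h

/-- The odd monochromatic `d` with `3 ≤ d < 512`. -/
def smallSpecial : List ℕ := [5, 7, 9, 17, 31, 33, 39, 65, 127, 129, 257, 511]

/-- For every other odd d below 512 some multiplier l ≤ 32 already gives r(ld) = 1. -/
theorem small_check : ((List.range 255).all fun i =>
    (smallSpecial.any fun s => Nat.beq s (2 * i + 3)) || findOdd 32 (2 * i + 3) 1) = true := by
  decide +kernel

theorem Monochromatic.small {d : ℕ} (h : Monochromatic d) (hodd : d % 2 = 1) (hd : 3 ≤ d)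
    (hd' : d < 512) : d ∈ smallSpecial := by
  have h1 := List.all_eq_true.1 small_check ((d - 3) / 2) (by rw [List.mem_range]; omega)
  rw [show 2 * ((d - 3) / 2) + 3 = d by omega, Bool.or_eq_true] at h1
  rcases h1 with h1 | h1
  · obtain ⟨s, hs, he⟩ := List.any_eq_true.1 h1
    rwa [← beq_iff.1 he]
  · exact absurd h (findOdd_sound _ _ _ h1)

/-- The odd `d` for which the progression is longer than `d / 2`. -/
theorem Monochromatic.special {d : ℕ} (h : Monochromatic d) (hodd : d % 2 = 1) (hd : 3 ≤ d) :
    ((∃ k : ℕ, 3 ≤ k ∧ Odd k ∧ d = 2 ^ k - 1) ∨ d = 39) ∨ ∃ k : ℕ, 2 ≤ k ∧ d = 2 ^ k + 1 := by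
  rcases lt_or_ge d 512 with hlt | hge
  · have := h.small hodd hd hlt
    simp only [smallSpecial, List.mem_cons, List.not_mem_nil, or_false] at this
    rcases this with rfl | rfl | rfl | rfl | rfl | rfl | rfl | rfl | rfl | rfl | rfl | rfl
    · exact Or.inr ⟨2, by norm_num⟩
    · exact Or.inl (Or.inl ⟨3, by decide⟩)
    · exact Or.inr ⟨3, by norm_num⟩
    · exact Or.inr ⟨4, by norm_num⟩
    · exact Or.inl (Or.inl ⟨5, by decide⟩)
    · exact Or.inr ⟨5, by norm_num⟩
    · exact Or.inl (Or.inr rfl)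
    · exact Or.inr ⟨6, by norm_num⟩
    · exact Or.inl (Or.inl ⟨7, by decide⟩)
    · exact Or.inr ⟨7, by norm_num⟩
    · exact Or.inr ⟨8, by norm_num⟩
    · exact Or.inl (Or.inl ⟨9, by decide⟩)
  · rcases h.eq_two_pow_add_or_sub_one hodd hge with ⟨K, hK, e⟩ | ⟨N, hN⟩
    · exact Or.inr ⟨K, by omega, e⟩
    · exact Or.inl (Or.inl ⟨N, hN⟩)

/-! ### Values and bounds of `A 0 d` -/

theorem A_zero_le {d l : ℕ} (hl : r (l * d) ≠ 0) : A 0 d ≤ l := by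
  suffices h : 1 ≤ l ∧ r (0 + l * d) ≠ r 0 from iInf₂_le l h
  constructor
  · rcases Nat.eq_zero_or_pos l with rfl | h
    · simp at hl
    · exact h
  · simpa using hl

theorem A_zero_eq {d l : ℕ} (hl : r (l * d) ≠ 0) (hmin : ∀ m < l, r (m * d) = 0) :
    A 0 d = l := by
  refine le_antisymm (A_zero_le hl) (le_iInf₂ fun m hm => ?_)
  by_contra hlt
  rw [not_le, Nat.cast_lt] at hlt
  exact hm.2 (by simpa using hmin m hlt)

theorem A_zero_two_mul (d : ℕ) : A 0 (2 * d) = A 0 d := by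
  have : ∀ l, r (l * (2 * d)) = r (l * d) := fun l => by
    rw [mul_left_comm, r_two_mul]
  simp [A, this]

theorem A_zero_two_pow (n : ℕ) : A 0 (2 ^ n) = 3 := by
  induction n with
  | zero =>
    refine A_zero_eq (l := 3) (by decide) fun m hm => ?_
    interval_cases m <;> decide
  | succ n ih => rw [pow_succ', A_zero_two_mul, ih]

/-- Here ld is l written twice, so the inner pairs cancel. Only the junction matters, and it first
produces a block 11 at l = 2^(k-1) + 1. -/
theorem A_zero_two_pow_add_one {k : ℕ} (hk : 2 ≤ k) :
    A 0 (2 ^ k + 1) = (2 ^ (k - 1) + 1 : ℕ) := by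
  obtain ⟨m, rfl⟩ : ∃ m, k = m + 1 := ⟨k - 1, by omega⟩
  have e : 2 ^ (m + 1) = 2 * 2 ^ m := by ring
  have hm : 2 ^ m % 2 = 0 := by
    rw [show m = m - 1 + 1 by omega, pow_succ]; omega
  have hm2 : 2 ≤ 2 ^ m := by
    calc 2 = 2 ^ 1 := by norm_num
      _ ≤ 2 ^ m := Nat.pow_le_pow_right (by norm_num) (by omega)
  rw [Nat.add_sub_cancel]
  apply A_zero_eq
  · rw [mul_add, mul_one, r_concat_of_le _ _ _ (by omega) (by omega)]
    omega
  · intro l hl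
    rw [mul_add, mul_one]
    rcases (show l < 2 ^ m ∨ l = 2 ^ m by omega) with h | h
    · rw [r_concat_of_lt _ _ _ h]; omega
    · rw [r_concat_of_le _ _ _ (by omega) (by omega)]; omega

/-- Here (l+1)d is l followed by its k-digit complement, so r is k - 1 mod 2, that is 0, for l <
2^(k-1). At l = 2^(k-1) the complement is k - 1 ones, with k - 2 blocks, an odd number. -/
theorem A_zero_two_pow_sub_one {k : ℕ} (hk : 3 ≤ k) (hodd : Odd k) :
    A 0 (2 ^ k - 1) = (2 ^ (k - 1) + 1 : ℕ) := by
  obtain ⟨m, rfl⟩ : ∃ m, k = m + 1 := ⟨k - 1, by omega⟩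
  rw [Nat.odd_iff] at hodd
  have e : 2 ^ (m + 1) = 2 * 2 ^ m := by ring
  have hm : 2 ^ m % 2 = 0 := by
    rw [show m = m - 1 + 1 by omega, pow_succ]; omega
  have hm2 : 4 ≤ 2 ^ m := by
    calc 4 = 2 ^ 2 := by norm_num
      _ ≤ 2 ^ m := Nat.pow_le_pow_right (by norm_num) (by omega)
  rw [Nat.add_sub_cancel]
  have key : ∀ l, l < 2 ^ (m + 1) →
      (l + 1) * (2 ^ (m + 1) - 1) = l * 2 ^ (m + 1) + (2 ^ (m + 1) - 1 - l) := by
    intro l hl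
    rw [Nat.mul_sub, add_mul l 1]
    omega
  apply A_zero_eq
  · rw [key _ (by omega), r_concat_of_lt _ _ _ (by omega), r_two_pow,
      show 2 ^ (m + 1) - 1 - 2 ^ m = 2 ^ (m - 1 + 1) - 1 - 0 by
        rw [show m - 1 + 1 = m by omega]; omega, r_two_pow_sub _ _ (by positivity), r_zero]
    omega
  · intro l hl
    rcases Nat.eq_zero_or_pos l with rfl | hl0
    · simp
    · obtain ⟨q, rfl⟩ : ∃ q, l = q + 1 := ⟨l - 1, by omega⟩
      rw [key _ (by omega), r_complement _ _ _ (by omega)]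
      omega

theorem A_zero_thirty_nine : A 0 39 = 21 := by
  refine A_zero_eq (l := 21) ?_ fun m hm => ?_
  · rw [← eval_toNat]; decide
  · rw [← eval_toNat]; interval_cases m <;> decide

theorem two_mul_A_zero_of_first {d : ℕ}
    (hd : (∃ k : ℕ, 3 ≤ k ∧ Odd k ∧ d = 2 ^ k - 1) ∨ d = 39) :
    2 * A 0 d = (d : ℕ∞) + 3 := by
  rcases hd with ⟨k, hk, hodd, rfl⟩ | rfl
  · rw [A_zero_two_pow_sub_one hk hodd]
    have e : 2 ^ k = 2 * 2 ^ (k - 1) := by rw [← pow_succ']; congr 1; omega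
    have hp : 0 < 2 ^ (k - 1) := by positivity
    exact_mod_cast (show 2 * (2 ^ (k - 1) + 1) = 2 ^ k - 1 + 3 by omega)
  · rw [A_zero_thirty_nine]; norm_num

theorem two_mul_A_zero_of_second {d : ℕ} (hd : ∃ k : ℕ, 2 ≤ k ∧ d = 2 ^ k + 1) :
    2 * A 0 d = (d : ℕ∞) + 1 := by
  obtain ⟨k, hk, rfl⟩ := hd
  rw [A_zero_two_pow_add_one hk]
  have e : 2 ^ k = 2 * 2 ^ (k - 1) := by rw [← pow_succ']; congr 1; omega
  exact_mod_cast (show 2 * (2 ^ (k - 1) + 1) = 2 ^ k + 1 + 1 by omega)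

theorem two_mul_A_zero_lt_of_not_monochromatic {d : ℕ} (hd : ¬ Monochromatic d) :
    2 * A 0 d < (d : ℕ∞) := by
  simp only [Monochromatic, not_forall] at hd
  obtain ⟨l, hl, hr⟩ := hd
  calc 2 * A 0 d ≤ 2 * (l : ℕ∞) := mul_le_mul_right (A_zero_le hr) _
    _ < d := by exact_mod_cast hl

theorem two_mul_A_zero_le_of_odd {d : ℕ} (hodd : d % 2 = 1) (hd : 3 ≤ d) :
    2 * A 0 d ≤ (d : ℕ∞) + 3 := by
  by_cases h : Monochromatic d
  · rcases h.special hodd hd with h | h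
    · exact (two_mul_A_zero_of_first h).le
    · rw [two_mul_A_zero_of_second h]
      exact_mod_cast (show d + 1 ≤ d + 3 by omega)
  · exact (two_mul_A_zero_lt_of_not_monochromatic h).le.trans (by simp)

theorem two_mul_A_zero_lt {d : ℕ} (hd : 3 ≤ d)
    (h1 : ¬ ((∃ k : ℕ, 3 ≤ k ∧ Odd k ∧ d = 2 ^ k - 1) ∨ d = 39))
    (h2 : ¬ ∃ k : ℕ, 2 ≤ k ∧ d = 2 ^ k + 1) (h4 : d ≠ 4) : 2 * A 0 d < (d : ℕ∞) := by
  by_cases hodd : d % 2 = 1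
  · apply two_mul_A_zero_lt_of_not_monochromatic
    intro h
    rcases h.special hodd hd with h | h
    · exact h1 h
    · exact h2 h
  · obtain ⟨a, u, hu, rfl⟩ := Nat.exists_eq_two_pow_mul_odd (n := d) (by omega)
    rw [Nat.odd_iff] at hu
    obtain ⟨b, rfl⟩ : ∃ b, a = b + 1 := by
      rcases Nat.eq_zero_or_pos a with rfl | ha
      · simp [hu] at hodd
      · exact ⟨a - 1, by omega⟩
    have hA : ∀ n, A 0 (2 ^ n * u) = A 0 u := by
      intro n
      induction n with
      | zero => simp
      | succ n ih => rw [pow_succ', mul_assoc, A_zero_two_mul, ih]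
    -- The bound 2·`A 0 u` ≤ u + 3 suffices only when u + 3 < 2u, so u = 1 and u = 3 are treated
    -- apart.
    rcases (show u = 1 ∨ u = 3 ∨ 5 ≤ u by omega) with rfl | rfl | h5
    · rw [mul_one] at *
      rw [A_zero_two_pow]
      have hb : 2 ≤ b := by
        by_contra hlt
        interval_cases b <;> simp at hd h4
      have : 2 ^ 3 ≤ 2 ^ (b + 1) := Nat.pow_le_pow_right (by norm_num) (by omega)
      exact_mod_cast (show 2 * 3 < 2 ^ (b + 1) by omega)
    · have h3 : A 0 3 ≤ (1 : ℕ) := A_zero_le (by decide)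
      rw [hA]
      calc 2 * A 0 3 ≤ 2 * ((1 : ℕ) : ℕ∞) := mul_le_mul_right h3 _
        _ < _ := by exact_mod_cast (show 2 * 1 < 2 ^ (b + 1) * 3 by omega)
    · rw [hA]
      refine (two_mul_A_zero_le_of_odd hu (by omega)).trans_lt ?_
      have : 2 * u ≤ 2 ^ (b + 1) * u := by
        rw [pow_succ', mul_assoc]
        exact Nat.mul_le_mul_left _ (Nat.le_mul_of_pos_left _ (by positivity))
      exact_mod_cast (show u + 3 < 2 ^ (b + 1) * u by omega)

end RudinShapiro

theorem theorem1p4 :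
    (∀ d : ℕ, 3 ≤ d → 2 * RudinShapiro.A 0 d ≤ (d : ℕ∞) + 3) ∧
    (∀ d : ℕ, 3 ≤ d →
      (2 * RudinShapiro.A 0 d = (d : ℕ∞) + 3 ↔
        (∃ k : ℕ, 3 ≤ k ∧ Odd k ∧ d = 2 ^ k - 1) ∨ d = 39)) ∧
    (∀ d : ℕ, 3 ≤ d →
      (2 * RudinShapiro.A 0 d = (d : ℕ∞) + 1 ↔ ∃ k : ℕ, 2 ≤ k ∧ d = 2 ^ k + 1)) ∧
    (∀ d : ℕ, 3 ≤ d →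
      ¬ ((∃ k : ℕ, 3 ≤ k ∧ Odd k ∧ d = 2 ^ k - 1) ∨ d = 39) →
      ¬ (∃ k : ℕ, 2 ≤ k ∧ d = 2 ^ k + 1) →
      d ≠ 4 →
      2 * RudinShapiro.A 0 d < (d : ℕ∞)) ∧
    RudinShapiro.A 0 4 = 3 := by
  have h4 : RudinShapiro.A 0 4 = 3 := RudinShapiro.A_zero_two_pow 2
  have e13 : ∀ d : ℕ, (d : ℕ∞) + 1 ≠ d + 3 := fun d => by
    exact_mod_cast (show d + 1 ≠ d + 3 by omega)
  have e41 : (2 : ℕ∞) * 3 ≠ ((4 : ℕ) : ℕ∞) + 1 := by norm_num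
  have e43 : (2 : ℕ∞) * 3 ≠ ((4 : ℕ) : ℕ∞) + 3 := by norm_num
  refine ⟨fun d hd => ?_, fun d hd => ⟨fun h => ?_, RudinShapiro.two_mul_A_zero_of_first⟩,
    fun d hd => ⟨fun h => ?_, RudinShapiro.two_mul_A_zero_of_second⟩,
    fun d hd => RudinShapiro.two_mul_A_zero_lt hd, h4⟩
  · by_cases h1 : (∃ k : ℕ, 3 ≤ k ∧ Odd k ∧ d = 2 ^ k - 1) ∨ d = 39
    · exact (RudinShapiro.two_mul_A_zero_of_first h1).le
    by_cases h2 : ∃ k : ℕ, 2 ≤ k ∧ d = 2 ^ k + 1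
    · rw [RudinShapiro.two_mul_A_zero_of_second h2]
      exact_mod_cast (show d + 1 ≤ d + 3 by omega)
    by_cases hd4 : d = 4
    · subst hd4
      rw [h4]
      norm_num
    · exact (RudinShapiro.two_mul_A_zero_lt hd h1 h2 hd4).le.trans (by simp)
  · by_contra h1
    by_cases h2 : ∃ k : ℕ, 2 ≤ k ∧ d = 2 ^ k + 1
    · exact e13 d ((RudinShapiro.two_mul_A_zero_of_second h2).symm.trans h)
    by_cases hd4 : d = 4
    · subst hd4
      exact e43 (h4 ▸ h)
    · have := RudinShapiro.two_mul_A_zero_lt hd h1 h2 hd4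
      rw [h] at this
      exact absurd this (by simp)
  · by_contra h2
    by_cases h1 : (∃ k : ℕ, 3 ≤ k ∧ Odd k ∧ d = 2 ^ k - 1) ∨ d = 39
    · exact e13 d (h.symm.trans (RudinShapiro.two_mul_A_zero_of_first h1))
    by_cases hd4 : d = 4
    · subst hd4
      exact e41 (h4 ▸ h)
    · have := RudinShapiro.two_mul_A_zero_lt hd h1 h2 hd4
      rw [h] at this
      exact absurd this (by simp)
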